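/- Let $n\in\mathbb N$, $0<t_1<T$, let $\sigma:\mathbb R^n\to\mathbb R$ be convex and let $H=H(t,p)\in C^1([0,T]\times\mathbb R^n)$ be real-valued. For $f:\mathbb R^n\to[-\infty,+\infty]$ write $f^*(y)=\sup_{x\in\mathbb R^n}\{\langle x,y\rangle-f(x)\}$ for the Fenchel conjugate. For $a<b$ and a function $\omega$ on $\mathbb R^n$ consider the following conditions on $[a,b]\times\mathbb R^n$. (A1) (with datum $\omega$) For every $(t_0,x_0)\in[a,b]\times\mathbb R^n$ there exist constants $r>0$ and $N>0$ such that $$\langle x,p\rangle-\omega^*(p)-\int_a^tH(\tau,p)\,d\tau<\max_{|q|\le N}\Big\{\langle x,q\rangle-\omega^*(q)-\int_a^tH(\tau,q)\,d\tau\Big\}$$ whenever $(t,x)\in[a,b]\times\mathbb R^n$, $|t-t_0|+|x-x_0|<r$ and $|p|>N$. (A2) Either $H(t,\cdot)$ is convex for all $t\in[a,b]$, or $H(t,\cdot)$ is concave for all $t\in[a,b]$, or $H(t,p)=g(t)h(p)+k(t)$ on $[a,b]\times\mathbb R^n$ for some real functions $g,h,k$ such that $g\ge0$ on $[a,b]$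 or $g\le0$ on $[a,b]$. Define $$u(t,x)=\Big(\sigma^*+\int_0^tH(\tau,\cdot)\,d\tau\Big)^*(x)\quad\text{for }(t,x)\in[0,t_1]\times\mathbb R^n,$$ $$u(t,x)=\Big(u(t_1,\cdot)^*+\int_{t_1}^tH(\tau,\cdot)\,d\tau\Big)^*(x)\quad\text{for }(t,x)\in[t_1,T]\times\mathbb R^n.$$ Suppose that (A1) with datum $\sigma$ and (A2) hold on $[0,t_1]\times\mathbb R^n$, and that (A1) with datum $u(t_1,\cdot)$ and (A2) hold on $[t_1,T]\times\mathbb R^n$. Then $u$ is well defined (the two formulas agree at $t=t_1$), finite on $[0,T]\times\mathbb R^n$, and is a viscosity solution on $\Omega=(0,T)\times\mathbb R^n$ of the Cauchy problem $$u_t+H(t,D_xu)=0\ \text{ in }\Omega,\qquad u(0,x)=\sigma(x),\ x\in\mathbb R^n,$$ that is: $u$ is continuous on $[0,T]\times\mathbb R^n$; $u(0,\cdot)=\sigma$; and for every $v\in C^1(\Omega)$ and $(t_0,x_0)\in\Omega$, $v_t(t_0,x_0)+H(t_0,D_xv(t_0,x_0))\le0$ if $u-v$ has a local maximum at $(t_0,x_0)$,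 and $v_t(t_0,x_0)+H(t_0,D_xv(t_0,x_0))\ge0$ if $u-v$ has a local minimum at $(t_0,x_0)$. -/

import Mathlib

open Set

noncomputable section

namespace LayeredHJ

/-- The space `ℝⁿ` with its Euclidean norm and scalar product. -/
abbrev E (n : ℕ) : Type := EuclideanSpace ℝ (Fin n)

/-- Fenchel conjugate `f*(y) = sup_x (⟨x, y⟩ - f x)` of an extended-real-valued function.
The first term is real, so the subtraction in `EReal` is never ambiguous. -/
def conjugate {n : ℕ} (f : E n → EReal) (y : E n) : EReal :=
  ⨆ x : E n, ((inner ℝ x y : ℝ) : EReal) - f x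

/-- Hopf-type formula with initial time `a` and initial datum `ω`:
`(ω* + ∫ₐᵗ H(τ, ·) dτ)* (x)`. -/
def hopf {n : ℕ} (H : ℝ → E n → ℝ) (ω : E n → EReal) (a t : ℝ) (x : E n) : EReal :=
  conjugate (fun q => conjugate ω q + ((∫ τ in a..t, H τ q : ℝ) : EReal)) x

/-- The expression `⟨x, q⟩ - ω*(q) - ∫ₐᵗ H(τ, q) dτ`; it is `-∞` where `ω*(q) = +∞`. -/
def objective {n : ℕ} (H : ℝ → E n → ℝ) (ω : E n → EReal) (a t : ℝ) (x q : E n) : EReal :=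
  ((inner ℝ x q : ℝ) : EReal) - conjugate ω q - ((∫ τ in a..t, H τ q : ℝ) : EReal)

/-- Condition (A1) on `[a, b] × ℝⁿ` for the initial datum `ω` at time `a`. The maximum over the
closed ball of radius `N` is written as a supremum in the extended reals. -/
def CondA1 {n : ℕ} (H : ℝ → E n → ℝ) (ω : E n → EReal) (a b : ℝ) : Prop :=
  ∀ t₀ ∈ Icc a b, ∀ x₀ : E n, ∃ r : ℝ, 0 < r ∧ ∃ N : ℝ, 0 < N ∧
    ∀ t ∈ Icc a b, ∀ x : E n, |t - t₀| + ‖x - x₀‖ < r → ∀ p : E n, N < ‖p‖ →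
      objective H ω a t x p < ⨆ q ∈ {q : E n | ‖q‖ ≤ N}, objective H ω a t x q

/-- Condition (A2) on `[a, b] × ℝⁿ`: `H(t, ·)` is convex for all `t`, or concave for all `t`, or
`H(t, p) = g(t) h(p) + k(t)` where `g` has a constant (weak) sign. -/
def CondA2 {n : ℕ} (H : ℝ → E n → ℝ) (a b : ℝ) : Prop :=
  ((∀ t ∈ Icc a b, ConvexOn ℝ univ (H t)) ∨ (∀ t ∈ Icc a b, ConcaveOn ℝ univ (H t))) ∨
  ∃ (g : ℝ → ℝ) (h : E n → ℝ) (k : ℝ → ℝ),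
    (∀ t ∈ Icc a b, ∀ p : E n, H t p = g t * h p + k t) ∧
    ((∀ t ∈ Icc a b, 0 ≤ g t) ∨ (∀ t ∈ Icc a b, g t ≤ 0))

/-- `u` is a viscosity solution on `(0, T) × ℝⁿ` of the Cauchy problem
`u_t + H(t, x, D_x u) = 0`, `u(0, ·) = σ`: it is continuous on `[0, T] × ℝⁿ`, attains the initial
datum, and satisfies the sub- and supersolution inequalities for all `C¹` test functions. -/
def IsViscositySolution {n : ℕ} (T : ℝ) (H : ℝ → E n → E n → ℝ) (σ : E n → ℝ)
    (u : ℝ → E n → ℝ) : Prop :=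
  ContinuousOn (fun z : ℝ × E n => u z.1 z.2) (Icc 0 T ×ˢ univ) ∧
  (∀ x : E n, u 0 x = σ x) ∧
  ∀ v : ℝ × E n → ℝ, ContDiffOn ℝ 1 v (Ioo 0 T ×ˢ univ) →
    ∀ t₀ ∈ Ioo 0 T, ∀ x₀ : E n,
      (IsLocalMax (fun z : ℝ × E n => u z.1 z.2 - v z) (t₀, x₀) →
        deriv (fun t => v (t, x₀)) t₀ + H t₀ x₀ (gradient (fun x => v (t₀, x)) x₀) ≤ 0) ∧
      (IsLocalMin (fun z : ℝ × E n => u z.1 z.2 - v z) (t₀, x₀) →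
        0 ≤ deriv (fun t => v (t, x₀)) t₀ + H t₀ x₀ (gradient (fun x => v (t₀, x)) x₀))

/-- The layered function: the Hopf-type formula with datum `σ` up to time `t₁`, then the Hopf-type
formula restarted at time `t₁` from the function reached at that time. -/
def layered {n : ℕ} (H : ℝ → E n → ℝ) (σ : E n → ℝ) (t₁ t : ℝ) (x : E n) : EReal :=
  if t ≤ t₁ then hopf H (fun y => (σ y : EReal)) 0 t x
  else hopf H (hopf H (fun y => (σ y : EReal)) 0 t₁) t₁ t x

end LayeredHJ

end

namespace LayeredHJ

open Filter Topology

variable {n : ℕ}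

/-! On each layer (A1) makes the Hopf formula a maximum over `q` of the phases `⟨x, q⟩ - ∫ₐᵗ H(τ, q)
dτ` minus `ω*(q)`, with locally bounded maximizers; `IsLayer` records this without extended reals.

Subsolution: each phase is a classical solution, and the phase of a maximizer touches `U` from
below, so a test function touching from above has its derivatives. A phase lying below the first
layer stays below the second, so the argument also works at `t₁`.

Supersolution: by Danskin's inequality and separation, the closed convex hull of the points `(-H(t₀,
q), q)`, `q` a maximizer, contains some `(α, p)` with `α ≤ v_t` and `p = D_x v`. It remains to see
that `α + H(t₀, p) ≥ 0` on this hull. Optimality of the `q`'s makes the time integral of Jensen's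
defect of `H` nonnegative, and (A2) gives that defect a constant sign, hence the right sign at `t₀`.
Only times `t ≤ t₀` enter, so at `t₁` the first layer suffices. -/

/-- A finite convex function on `ℝⁿ` has a subgradient at every point. -/
theorem exists_subgradient {ω : E n → ℝ} (hω : ConvexOn ℝ univ ω) (x₀ : E n) :
    ∃ q : E n, ∀ x, ω x₀ + inner ℝ (x - x₀) q ≤ ω x := by
  have hcont : Continuous ω := hω.locallyLipschitz.continuous
  have hopen : IsOpen {z : E n × ℝ | z.1 ∈ univ ∧ ω z.1 < z.2} := by
    simpa using isOpen_lt (hcont.comp continuous_fst) continuous_snd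
  obtain ⟨f, hf⟩ := geometric_hahn_banach_open_point (x := (x₀, ω x₀))
    hω.convex_strict_epigraph hopen (by simp)
  have hsplit : ∀ x r, f (x, r) = f (x, 0) + r * f (0, 1) := fun x r => by
    rw [← smul_eq_mul, ← map_smul, ← map_add]; simp
  have hneg : f (0, 1) < 0 := by
    have := hf (x₀, ω x₀ + 1) (by simp)
    rw [hsplit, hsplit x₀ (ω x₀)] at this
    linarith
  obtain ⟨w, hw⟩ : ∃ w : E n, ∀ x, f (x, 0) = inner ℝ w x :=
    ⟨(InnerProductSpace.toDual ℝ (E n)).symm (f.comp (ContinuousLinearMap.inl ℝ (E n) ℝ)),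
      fun x => by simp⟩
  have hle : ∀ x, f (x, ω x) ≤ f (x₀, ω x₀) := fun x => by
    refine le_of_forall_pos_le_add fun ε hε => ?_
    -- Points of the graph are not in the strict epigraph; this height above the graph changes `f`
    -- by exactly `-ε`.
    have := hf (x, ω x + ε / (-f (0, 1))) (by simpa using div_pos hε (neg_pos.2 hneg))
    rw [hsplit] at this
    rw [hsplit]
    have h2 : ε / (-f (0, 1)) * f (0, 1) = -ε := by
      rw [div_neg, neg_mul, div_mul_cancel₀ _ hneg.ne]
    nlinarith
  refine ⟨(-f (0, 1))⁻¹ • w, fun x => ?_⟩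
  have h := hle x
  rw [hsplit, hsplit x₀, hw, hw] at h
  rw [inner_smul_right, inner_sub_left, real_inner_comm, real_inner_comm w x₀]
  have hpos : 0 < -f (0, 1) := by linarith
  rw [← mul_le_mul_iff_right₀ hpos, mul_add, mul_inv_cancel_left₀ hpos.ne']
  linarith

/-! ### Phases and the Hopf formula in real terms. -/

/-- The Fenchel conjugate of `ω` at `q` is at most `m`. -/
def ConjLE (ω : E n → ℝ) (q : E n) (m : ℝ) : Prop := ∀ x, inner ℝ x q - ω x ≤ m

/-- `⟨x, q⟩ - ∫ₐᵗ H(τ, q) dτ`. -/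
noncomputable def phase (H : ℝ → E n → ℝ) (a t : ℝ) (x q : E n) : ℝ := inner ℝ x q - ∫ τ in a..t, H τ q

theorem continuous_phase {H : ℝ → E n → ℝ} (hH : Continuous H.uncurry) (a : ℝ) :
    Continuous fun z : (ℝ × E n) × E n => phase H a z.1.1 z.1.2 z.2 := by
  have h : Continuous fun z : (ℝ × E n) × E n => ∫ τ in a..z.1.1, H τ z.2 :=
    intervalIntegral.continuous_parametric_intervalIntegral_of_continuous
      (f := fun (z : (ℝ × E n) × E n) τ => H τ z.2) (s := fun z => z.1.1)
      (hH.comp (by fun_prop : Continuous fun w : ((ℝ × E n) × E n) × ℝ => (w.2, w.1.2)))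
      (by fun_prop)
  unfold phase
  fun_prop

theorem eventually_phase_close {H : ℝ → E n → ℝ} (hH : Continuous H.uncurry) (a : ℝ)
    (z₀ : ℝ × E n) (N : ℝ) {ε : ℝ} (hε : 0 < ε) :
    ∀ᶠ z : ℝ × E n in 𝓝 z₀, ∀ q : E n, ‖q‖ ≤ N →
      |phase H a z₀.1 z₀.2 q - phase H a z.1 z.2 q| < ε := by
  have hc : Continuous fun w : (ℝ × E n) × E n =>
      |phase H a z₀.1 z₀.2 w.2 - phase H a w.1.1 w.1.2 w.2| := by
    refine (Continuous.sub ?_ (continuous_phase hH a)).abs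
    exact (continuous_phase hH a).comp
      (by fun_prop : Continuous fun w : (ℝ × E n) × E n => (z₀, w.2))
  have := (isCompact_closedBall (0 : E n) N).eventually_forall_of_forall_eventually
    (x₀ := z₀) (P := fun z q => |phase H a z₀.1 z₀.2 q - phase H a z.1 z.2 q| < ε)
    fun q _ => hc.continuousAt.eventually_lt_const (by simpa using hε)
  simpa using this

/-- `U` is the Hopf-type function on `[a, b]` with datum `ω`, in real terms: the supremum in the
formula is attained, and its maximizers are locally bounded. -/
structure IsLayer (H : ℝ → E n → ℝ) (ω : E n → ℝ) (a b : ℝ) (U : ℝ → E n → ℝ) : Prop where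
  upper : ∀ t ∈ Icc a b, ∀ x q m, ConjLE ω q m → phase H a t x q - m ≤ U t x
  attained : ∀ t ∈ Icc a b, ∀ x, ∃ q, ConjLE ω q (phase H a t x q - U t x)
  locBdd : ∀ t₀ ∈ Icc a b, ∀ x₀, ∃ N : ℝ, ∀ᶠ z : ℝ × E n in 𝓝 (t₀, x₀), z.1 ∈ Icc a b →
    ∀ q, ConjLE ω q (phase H a z.1 z.2 q - U z.1 z.2) → ‖q‖ ≤ N

/-- Convexity of the Fenchel conjugate, in finite Jensen form. -/
theorem ConjLE.sum {ω : E n → ℝ} {ι : Type*} {s : Finset ι} {w m : ι → ℝ} {q : ι → E n}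
    (hw : ∀ i ∈ s, 0 ≤ w i) (hw1 : ∑ i ∈ s, w i = 1) (h : ∀ i ∈ s, ConjLE ω (q i) (m i)) :
    ConjLE ω (∑ i ∈ s, w i • q i) (∑ i ∈ s, w i * m i) := by
  intro x
  have h1 : ∑ i ∈ s, w i * (inner ℝ x (q i) - ω x) ≤ ∑ i ∈ s, w i * m i :=
    Finset.sum_le_sum fun i hi => mul_le_mul_of_nonneg_left (h i hi x) (hw i hi)
  simp only [mul_sub, Finset.sum_sub_distrib, ← Finset.sum_mul, hw1, one_mul] at h1
  simpa [inner_sum, inner_smul_right] using h1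

namespace IsLayer

variable {H : ℝ → E n → ℝ} {ω : E n → ℝ} {a b : ℝ} {U : ℝ → E n → ℝ}

/-- At `t = a` the formula is the biconjugate, and a subgradient of `ω` at `x` attains the value `ω
x`. This also makes the two formulas agree at `t₁`. -/
theorem initial (hU : IsLayer H ω a b U) (hab : a ≤ b) (hω : ConvexOn ℝ univ ω) (x : E n) :
    U a x = ω x := by
  apply le_antisymm
  · obtain ⟨q, hq⟩ := hU.attained a (left_mem_Icc.2 hab) x
    have := hq x
    simp only [phase, intervalIntegral.integral_same] at this
    linarith
  · obtain ⟨q, hq⟩ := exists_subgradient hω x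
    have := hU.upper a (left_mem_Icc.2 hab) x q (inner ℝ x q - ω x) fun y => by
      have := hq y
      rw [inner_sub_left] at this
      linarith
    simp only [phase, intervalIntegral.integral_same] at this
    linarith

/-- A supremum of functions affine in `x`; the second layer thus starts from a convex datum. -/
theorem convexOn (hU : IsLayer H ω a b U) {t : ℝ} (ht : t ∈ Icc a b) :
    ConvexOn ℝ univ (U t) := by
  refine ⟨convex_univ, fun x _ y _ α β hα hβ hαβ => ?_⟩
  obtain ⟨q, hq⟩ := hU.attained t ht (α • x + β • y)
  have hx := mul_le_mul_of_nonneg_left (hU.upper t ht x q _ hq) hα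
  have hy := mul_le_mul_of_nonneg_left (hU.upper t ht y q _ hq) hβ
  simp only [phase, inner_add_left, inner_smul_left, smul_eq_mul, conj_trivial] at hx hy ⊢
  obtain rfl : β = 1 - α := by linarith
  linarith

/-- A maximizer at either of two nearby points is a competitor at the other. All of them lie in one
ball, where the phases are uniformly close. -/
theorem continuousOn (hU : IsLayer H ω a b U) (hH : Continuous H.uncurry) :
    ContinuousOn (fun z : ℝ × E n => U z.1 z.2) (Icc a b ×ˢ univ) := by
  rintro ⟨t₀, x₀⟩ ⟨ht₀, -⟩
  simp only at ht₀
  obtain ⟨N, hN⟩ := hU.locBdd t₀ ht₀ x₀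
  obtain ⟨q₀, hq₀⟩ := hU.attained t₀ ht₀ x₀
  have hq₀N := hN.self_of_nhds ht₀ q₀ hq₀
  rw [ContinuousWithinAt, Metric.tendsto_nhds]
  intro ε hε
  have hunif := eventually_phase_close hH a (t₀, x₀) N hε
  filter_upwards [nhdsWithin_le_nhds hN, nhdsWithin_le_nhds hunif, self_mem_nhdsWithin]
    with z hzN hz hzmem
  obtain ⟨q, hq⟩ := hU.attained z.1 hzmem.1 z.2
  have h1 := hU.upper z.1 hzmem.1 z.2 q₀ _ hq₀
  have h2 := hU.upper t₀ ht₀ x₀ q _ hq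
  have h3 := hz q₀ hq₀N
  have h4 := hz q (hzN hzmem.1 q hq)
  rw [abs_lt] at h3 h4
  rw [Real.dist_eq, abs_lt]
  constructor <;> linarith

end IsLayer

/-! ### Jensen's defect under (A2). -/

/-- A continuous function of constant weak sign with nonnegative integral over `[a, t₀]` is
nonnegative at `t₀`. -/
theorem nonneg_right_of_integral_nonneg {D : ℝ → ℝ} (hD : Continuous D) {a b t₀ : ℝ}
    (ht₀ : t₀ ∈ Ioc a b) (hsign : (∀ t ∈ Icc a b, 0 ≤ D t) ∨ (∀ t ∈ Icc a b, D t ≤ 0))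
    (hint : 0 ≤ ∫ t in a..t₀, D t) : 0 ≤ D t₀ := by
  rcases hsign with h | h
  · exact h t₀ ⟨ht₀.1.le, ht₀.2⟩
  · by_contra! hlt
    have := intervalIntegral.integral_pos (f := fun t => -D t) ht₀.1 hD.neg.continuousOn
      (fun t ht => neg_nonneg.2 (h t ⟨ht.1.le, ht.2.trans ht₀.2⟩))
      ⟨t₀, right_mem_Icc.2 ht₀.1.le, neg_pos.2 hlt⟩
    rw [intervalIntegral.integral_neg] at this
    linarith

/-- Under (A2), Jensen's defect of `H(t, ·)` has a sign that does not depend on `t`. -/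
theorem CondA2.jensen_sign {H : ℝ → E n → ℝ} {a b : ℝ} (hA2 : CondA2 H a b) {ι : Type*}
    {s : Finset ι} {w : ι → ℝ} (q : ι → E n) (hw : ∀ i ∈ s, 0 ≤ w i) (hw1 : ∑ i ∈ s, w i = 1) :
    (∀ t ∈ Icc a b, 0 ≤ H t (∑ i ∈ s, w i • q i) - ∑ i ∈ s, w i * H t (q i)) ∨
    (∀ t ∈ Icc a b, H t (∑ i ∈ s, w i • q i) - ∑ i ∈ s, w i * H t (q i) ≤ 0) := by
  rcases hA2 with (h | h) | ⟨g, h, k, hgh, hg⟩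
  · exact Or.inr fun t ht => sub_nonpos.2 (by
      simpa using (h t ht).map_sum_le hw hw1 fun i _ => mem_univ (q i))
  · exact Or.inl fun t ht => sub_nonneg.2 (by
      simpa using (h t ht).le_map_sum hw hw1 fun i _ => mem_univ (q i))
  · have key : ∀ t ∈ Icc a b, H t (∑ i ∈ s, w i • q i) - ∑ i ∈ s, w i * H t (q i)
        = g t * (h (∑ i ∈ s, w i • q i) - ∑ i ∈ s, w i * h (q i)) := fun t ht => by
      have : ∑ i ∈ s, w i * H t (q i) = g t * ∑ i ∈ s, w i * h (q i) + k t := by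
        calc ∑ i ∈ s, w i * H t (q i) = ∑ i ∈ s, (g t * (w i * h (q i)) + w i * k t) :=
              Finset.sum_congr rfl fun i _ => by rw [hgh t ht]; ring
          _ = _ := by rw [Finset.sum_add_distrib, ← Finset.mul_sum, ← Finset.sum_mul, hw1, one_mul]
      rw [this, hgh t ht]; ring
    rcases le_total 0 (h (∑ i ∈ s, w i • q i) - ∑ i ∈ s, w i * h (q i)) with hc | hc <;>
      rcases hg with hg | hg
    · exact Or.inl fun t ht => key t ht ▸ mul_nonneg (hg t ht) hc
    · exact Or.inr fun t ht => key t ht ▸ mul_nonpos_of_nonpos_of_nonneg (hg t ht) hc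
    · exact Or.inr fun t ht => key t ht ▸ mul_nonpos_of_nonneg_of_nonpos (hg t ht) hc
    · exact Or.inl fun t ht => key t ht ▸ mul_nonneg_of_nonpos_of_nonpos (hg t ht) hc

/-! ### Supersolution inequality. -/

theorem tendsto_phase {H : ℝ → E n → ℝ} (hH : Continuous H.uncurry) (a : ℝ) {α : Type*}
    {l : Filter α} {z : α → ℝ × E n} {q : α → E n} {z₀ : ℝ × E n} {q₀ : E n}
    (hz : Tendsto z l (𝓝 z₀)) (hq : Tendsto q l (𝓝 q₀)) :
    Tendsto (fun k => phase H a (z k).1 (z k).2 (q k)) l (𝓝 (phase H a z₀.1 z₀.2 q₀)) := by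
  have h1 := hz.prodMk_nhds hq
  have h2 := (continuous_phase hH a).tendsto (z₀, q₀)
  have h3 := h2.comp h1
  simpa [Function.comp_def] using h3

/-- Rescaling the time integral to `[0, 1]` factors out `ε` and leaves a quotient continuous in `(ε,
q)` up to `ε = 0`. -/
theorem phase_add_smul_sub {H : ℝ → E n → ℝ} (hH : Continuous H.uncurry) (a t₀ s ε : ℝ)
    (x₀ y q : E n) :
    phase H a (t₀ + ε * s) (x₀ + ε • y) q - phase H a t₀ x₀ q
      = ε * (inner ℝ y q - s * ∫ θ in (0 : ℝ)..1, H (t₀ + ε * s * θ) q) := by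
  have hc : Continuous fun τ => H τ q :=
    hH.comp (by fun_prop : Continuous fun τ : ℝ => (τ, q))
  have h1 : (∫ τ in a..(t₀ + ε * s), H τ q) - ∫ τ in a..t₀, H τ q
      = ε * s * ∫ θ in (0 : ℝ)..1, H (t₀ + ε * s * θ) q := by
    rw [intervalIntegral.integral_interval_sub_left (hc.intervalIntegrable _ _)
      (hc.intervalIntegrable _ _)]
    simpa using (intervalIntegral.smul_integral_comp_add_mul (a := 0) (b := 1) (fun τ => H τ q)
      (ε * s) t₀).symm
  simp only [phase, inner_add_left, inner_smul_left, conj_trivial]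
  linear_combination -h1

namespace IsLayer

variable {H : ℝ → E n → ℝ} {ω : E n → ℝ} {a b : ℝ} {U : ℝ → E n → ℝ}

/-- Danskin's inequality, backwards in time: if `v` touches `U` from below at `(t₀, x₀)` on
`t ≤ t₀`, then its derivative in a direction `(s, y)`, `s ≤ 0`, is bounded by that of the phase of
some maximizer. -/
theorem exists_maximizer_fderiv_le (hU : IsLayer H ω a b U) (hH : Continuous H.uncurry) {t₀ : ℝ}
    (ht₀ : t₀ ∈ Ioc a b) {x₀ : E n} {v : ℝ × E n → ℝ} {v' : ℝ × E n →L[ℝ] ℝ}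
    (hv : HasFDerivAt v v' (t₀, x₀))
    (hmin : ∀ᶠ z : ℝ × E n in 𝓝 (t₀, x₀), z.1 ≤ t₀ →
      U t₀ x₀ - v (t₀, x₀) ≤ U z.1 z.2 - v z)
    {s : ℝ} (hs : s ≤ 0) (y : E n) :
    ∃ q, ConjLE ω q (phase H a t₀ x₀ q - U t₀ x₀) ∧ v' (s, y) ≤ inner ℝ y q - s * H t₀ q := by
  have ht₀' : t₀ ∈ Icc a b := Ioc_subset_Icc_self ht₀
  set c : ℕ → ℝ := fun k => (k : ℝ) + 1 with hc
  have hcpos : ∀ k, 0 < c k := fun k => by positivity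
  have hctop : Tendsto c atTop atTop := tendsto_atTop_add_const_right _ _ tendsto_natCast_atTop_atTop
  have hε : Tendsto (fun k => (c k)⁻¹) atTop (𝓝 0) := hctop.inv_tendsto_atTop
  set z : ℕ → ℝ × E n := fun k => (t₀ + (c k)⁻¹ * s, x₀ + (c k)⁻¹ • y) with hzdef
  have hz : Tendsto z atTop (𝓝 (t₀, x₀)) := by
    have h1 : Tendsto (fun k => t₀ + (c k)⁻¹ * s) atTop (𝓝 t₀) := by
      simpa using (hε.mul_const s).const_add t₀
    have h2 : Tendsto (fun k => x₀ + (c k)⁻¹ • y) atTop (𝓝 x₀) := by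
      simpa using (hε.smul_const y).const_add x₀
    exact h1.prodMk_nhds h2
  have hzle : ∀ k, (z k).1 ≤ t₀ := fun k => by
    have := mul_nonpos_of_nonneg_of_nonpos (inv_nonneg.2 (hcpos k).le) hs
    simp only [hzdef]; linarith
  have hzmem : ∀ᶠ k in atTop, (z k).1 ∈ Icc a b := by
    have : ∀ᶠ k in atTop, a < (z k).1 :=
      ((continuous_fst.tendsto _).comp hz).eventually_const_lt ht₀.1
    filter_upwards [this] with k hk using ⟨hk.le, (hzle k).trans ht₀.2⟩
  obtain ⟨N, hN⟩ := hU.locBdd t₀ ht₀' x₀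
  obtain ⟨q, hq⟩ : ∃ q : ℕ → E n, ∀ᶠ k in atTop,
      ConjLE ω (q k) (phase H a (z k).1 (z k).2 (q k) - U (z k).1 (z k).2) :=
    Eventually.choice (hzmem.mono fun k hk => hU.attained _ hk _)
  have hqN : ∀ᶠ k in atTop, q k ∈ Metric.closedBall (0 : E n) N := by
    filter_upwards [hz.eventually hN, hzmem, hq] with k h1 h2 h3
    simpa using h1 h2 _ h3
  set J : ℕ → ℝ := fun k =>
    inner ℝ y (q k) - s * ∫ θ in (0 : ℝ)..1, H (t₀ + (c k)⁻¹ * s * θ) (q k) with hJ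
  have hvJ : ∀ᶠ k in atTop, c k • (v ((t₀, x₀) + (c k)⁻¹ • (s, y)) - v (t₀, x₀)) ≤ J k := by
    filter_upwards [hz.eventually hmin, hq] with k h1 h2
    have h3 := h1 (hzle k)
    have h4 := hU.upper t₀ ht₀' x₀ (q k) _ h2
    have h5 := phase_add_smul_sub hH a t₀ s (c k)⁻¹ x₀ y (q k)
    have h6 : v (z k) - v (t₀, x₀) ≤ (c k)⁻¹ * J k := by
      rw [hJ]; simp only; rw [← h5]; simp only [hzdef] at h3 h4 ⊢; linarith
    have h7 : (t₀, x₀) + (c k)⁻¹ • (s, y) = z k := by simp [hzdef]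
    rw [h7, smul_eq_mul]
    calc _ ≤ c k * ((c k)⁻¹ * J k) := mul_le_mul_of_nonneg_left h6 (hcpos k).le
      _ = J k := by rw [mul_inv_cancel_left₀ (hcpos k).ne']
  -- The maximizers at `z k` stay in a ball; a limit point is a maximizer at `(t₀, x₀)`, and the
  -- difference quotients pass to the limit along the subsequence.
  obtain ⟨q', -, φ, hφ, hφq⟩ :=
    (isCompact_closedBall (0 : E n) N).tendsto_subseq' hqN.frequently
  have hφt := hφ.tendsto_atTop
  refine ⟨q', fun x => ?_, ?_⟩
  · have hUlim : Tendsto (fun k => U (z k).1 (z k).2) atTop (𝓝 (U t₀ x₀)) :=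
      Tendsto.comp (hU.continuousOn hH (t₀, x₀) ⟨ht₀', mem_univ _⟩)
        (tendsto_nhdsWithin_iff.2 ⟨hz, hzmem.mono fun k hk => ⟨hk, mem_univ _⟩⟩)
    have hPlim : Tendsto (fun k => phase H a (z (φ k)).1 (z (φ k)).2 (q (φ k))) atTop
        (𝓝 (phase H a t₀ x₀ q')) :=
      tendsto_phase hH a (hz.comp hφt) hφq
    have hleft : Tendsto (fun k => inner ℝ x (q (φ k)) - ω x) atTop
        (𝓝 (inner ℝ x q' - ω x)) := (tendsto_const_nhds.inner hφq).sub_const (ω x)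
    have hUlim' : Tendsto (fun k => U (z (φ k)).1 (z (φ k)).2) atTop (𝓝 (U t₀ x₀)) :=
      hUlim.comp hφt
    have hev := hφt.eventually hq
    exact le_of_tendsto_of_tendsto hleft (hPlim.sub hUlim') (hev.mono fun k hk => hk x)
  · have hI : Continuous fun w : ℝ × E n => ∫ θ in (0 : ℝ)..1, H (t₀ + w.1 * s * θ) w.2 :=
      intervalIntegral.continuous_parametric_intervalIntegral_of_continuous'
        (f := fun (w : ℝ × E n) θ => H (t₀ + w.1 * s * θ) w.2)
        (hH.comp (by fun_prop :
          Continuous fun w : (ℝ × E n) × ℝ => (t₀ + w.1.1 * s * w.2, w.1.2))) 0 1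
    have hIlim := (hI.tendsto (0, q')).comp ((hε.comp hφt).prodMk_nhds hφq)
    have hJlim : Tendsto (fun k => J (φ k)) atTop (𝓝 (inner ℝ y q' - s * H t₀ q')) := by
      have := (tendsto_const_nhds (x := y) |>.inner hφq (𝕜 := ℝ)).sub (hIlim.const_mul s)
      simpa using this
    have hvlim := (hv.lim (s, y) (c := c) (l := atTop)
      (tendsto_norm_atTop_atTop.comp hctop)).comp hφt
    exact le_of_tendsto_of_tendsto hvlim hJlim (hφt.eventually hvJ)

/-- Supersolution inequality at `(t₀, x₀)`; only times `t ≤ t₀` matter. -/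
theorem supersolution (hU : IsLayer H ω a b U) (hH : Continuous H.uncurry)
    (hA2 : CondA2 H a b) {t₀ : ℝ} (ht₀ : t₀ ∈ Ioc a b) {x₀ : E n} {v : ℝ × E n → ℝ}
    {v' : ℝ × E n →L[ℝ] ℝ} (hv : HasFDerivAt v v' (t₀, x₀))
    (hmin : ∀ᶠ z : ℝ × E n in 𝓝 (t₀, x₀), z.1 ≤ t₀ →
      U t₀ x₀ - v (t₀, x₀) ≤ U z.1 z.2 - v z)
    {p : E n} (hp : ∀ y, v' (0, y) = inner ℝ y p) :
    0 ≤ v' (1, 0) + H t₀ p := by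
  have ht₀' : t₀ ∈ Icc a b := Ioc_subset_Icc_self ht₀
  have hHt : ∀ q, Continuous fun τ => H τ q := fun q =>
    hH.comp (by fun_prop : Continuous fun τ : ℝ => (τ, q))
  have hv'split : ∀ s y, v' (s, y) = s * v' (1, 0) + inner ℝ y p := fun s y => by
    rw [← hp, ← smul_eq_mul, ← map_smul, ← map_add]; simp
  set L : Set (E n) := {q | ConjLE ω q (phase H a t₀ x₀ q - U t₀ x₀)} with hL
  set C : Set (ℝ × E n) := (fun q => (-H t₀ q, q)) '' L with hC
  obtain ⟨N, hN⟩ := hU.locBdd t₀ ht₀' x₀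
  have hLN : L ⊆ Metric.closedBall 0 N := fun q hq => by
    simpa using hN.self_of_nhds ht₀' q hq
  have hH0 : Continuous fun q => H t₀ q :=
    hH.comp (by fun_prop : Continuous fun q : E n => (t₀, q))
  have hCbdd : Bornology.IsBounded C :=
    (((isCompact_closedBall (0 : E n) N).image (by fun_prop :
      Continuous fun q => (-H t₀ q, q))).isBounded).subset (image_mono hLN)
  have hK : IsCompact (closure (convexHull ℝ C)) :=
    (isBounded_convexHull.2 hCbdd).isCompact_closure
  have hKH : ∀ w ∈ closure (convexHull ℝ C), 0 ≤ w.1 + H t₀ w.2 := by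
    have hclosed : IsClosed {w : ℝ × E n | 0 ≤ w.1 + H t₀ w.2} :=
      isClosed_le continuous_const (continuous_fst.add (hH0.comp continuous_snd))
    refine fun w hw => closure_minimal (fun w hw => ?_) hclosed hw
    rw [convexHull_eq] at hw
    obtain ⟨ι, S, l, ζ, hl, hl1, hζ, rfl⟩ := hw
    rw [Finset.centerMass_eq_of_sum_1 _ _ hl1]
    have hζ' : ∀ i ∈ S, (ζ i).1 = -H t₀ (ζ i).2 ∧ (ζ i).2 ∈ L := fun i hi => by
      obtain ⟨q, hq, hqe⟩ := hζ i hi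
      rw [← hqe]; exact ⟨rfl, hq⟩
    simp only [mem_ofPred_eq, Prod.fst_sum, Prod.snd_sum, Prod.smul_fst, Prod.smul_snd,
      smul_eq_mul]
    have hfst : ∑ i ∈ S, l i * (ζ i).1 = -∑ i ∈ S, l i * H t₀ (ζ i).2 := by
      rw [← Finset.sum_neg_distrib]
      exact Finset.sum_congr rfl fun i hi => by rw [(hζ' i hi).1]; ring
    set D : ℝ → ℝ := fun t =>
      H t (∑ i ∈ S, l i • (ζ i).2) - ∑ i ∈ S, l i * H t (ζ i).2 with hD
    have hDc : Continuous D :=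
      (hHt _).sub (continuous_finsetSum _ fun i _ => (hHt _).const_mul (l i))
    suffices 0 ≤ D t₀ by rw [hfst]; simp only [hD] at this; linarith
    refine nonneg_right_of_integral_nonneg hDc ht₀
      (hA2.jensen_sign (fun i => (ζ i).2) hl hl1) ?_
    have hint : ∫ t in a..t₀, D t = (∫ t in a..t₀, H t (∑ i ∈ S, l i • (ζ i).2))
        - ∑ i ∈ S, l i * ∫ t in a..t₀, H t (ζ i).2 := by
      rw [hD, intervalIntegral.integral_sub ((hHt _).intervalIntegrable _ _)
        ((continuous_finsetSum _ fun i _ => (hHt _).const_mul (l i)).intervalIntegrable _ _),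
        intervalIntegral.integral_finsetSum
          fun i _ => ((hHt _).const_mul (l i)).intervalIntegrable _ _]
      simp only [intervalIntegral.integral_const_mul]
    -- The average of the maximizers is only a competitor, while its conjugate is at most the
    -- average of theirs: linear terms cancel and the integrated defect is left.
    have hup := hU.upper t₀ ht₀' x₀ _ _ (ConjLE.sum hl hl1 fun i hi => (hζ' i hi).2)
    simp only [phase, mul_sub, Finset.sum_sub_distrib, ← Finset.sum_mul, hl1, inner_sum,
      inner_smul_right] at hup
    rw [hint]
    linarith
  by_contra! hlt
  set R : Set (ℝ × E n) := Iic (v' (1, 0)) ×ˢ {p} with hR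
  have hdisj : Disjoint (closure (convexHull ℝ C)) R := by
    rw [disjoint_left]
    rintro ⟨α, q⟩ hw ⟨hα, hq⟩
    have := hKH _ hw
    simp only [mem_Iic, mem_singleton_iff] at hα hq this
    subst hq
    linarith
  obtain ⟨f, u₁, u₂, hf1, hu, hf2⟩ := geometric_hahn_banach_compact_closed
    (convex_convexHull ℝ C).closure hK ((convex_Iic _).prod (convex_singleton p))
    (isClosed_Iic.prod isClosed_singleton) hdisj
  have hfsplit : ∀ α x, f (α, x) = α * f (1, 0) + f (0, x) := fun α x => by
    rw [← smul_eq_mul, ← map_smul, ← map_add]; simp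
  obtain ⟨y, hy⟩ : ∃ y : E n, ∀ x, f (0, x) = inner ℝ y x :=
    ⟨(InnerProductSpace.toDual ℝ (E n)).symm (f.comp (ContinuousLinearMap.inr ℝ ℝ (E n))),
      fun x => by simp⟩
  -- `R` extends to `-∞` in its first coordinate while `f > u₂` on it. With a positive slope, the
  -- point below would have value at most `u₂`.
  have hs : f (1, 0) ≤ 0 := by
    by_contra! hpos
    have hmem : (v' (1, 0) - (|v' (1, 0) * f (1, 0) + inner ℝ y p - u₂|) / f (1, 0), p) ∈ R :=
      ⟨by simp only [mem_Iic]; have := div_nonneg (abs_nonneg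
        (v' (1, 0) * f (1, 0) + inner ℝ y p - u₂)) hpos.le; linarith, rfl⟩
    have := hf2 _ hmem
    rw [hfsplit, hy, sub_mul, div_mul_cancel₀ _ hpos.ne'] at this
    have := le_abs_self (v' (1, 0) * f (1, 0) + inner ℝ y p - u₂)
    linarith
  -- The separating functional is itself a backward direction `(s, y)` with `s = f (1, 0)`;
  -- Danskin's inequality in that direction contradicts strict separation.
  obtain ⟨q, hq, hle⟩ := hU.exists_maximizer_fderiv_le hH ht₀ hv hmin hs y
  have h1 := hf1 (-H t₀ q, q) (subset_closure (subset_convexHull ℝ C ⟨q, hq, rfl⟩))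
  have h2 := hf2 (v' (1, 0), p) ⟨self_mem_Iic, rfl⟩
  rw [hfsplit, hy] at h1 h2
  rw [hv'split] at hle
  linarith

end IsLayer

/-! ### Subsolution inequality. -/

/-- Subsolution inequality for a function touched from below by a phase. -/
theorem subsolution_of_phase_le {H : ℝ → E n → ℝ} (hH : Continuous H.uncurry) {a t₀ m : ℝ}
    {x₀ q : E n} {u v : ℝ × E n → ℝ} {v' : ℝ × E n →L[ℝ] ℝ} (hv : HasFDerivAt v v' (t₀, x₀))
    (hle : ∀ᶠ z : ℝ × E n in 𝓝 (t₀, x₀), phase H a z.1 z.2 q - m ≤ u z)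
    (heq : u (t₀, x₀) ≤ phase H a t₀ x₀ q - m)
    (hmax : IsLocalMax (fun z => u z - v z) (t₀, x₀))
    {p : E n} (hp : ∀ y, v' (0, y) = inner ℝ y p) :
    v' (1, 0) + H t₀ p ≤ 0 := by
  have hloc : IsLocalMax (fun z : ℝ × E n => phase H a z.1 z.2 q - v z) (t₀, x₀) := by
    filter_upwards [hle, hmax] with z h1 h2
    linarith
  have hc : Continuous fun τ => H τ q :=
    hH.comp (by fun_prop : Continuous fun τ : ℝ => (τ, q))
  have hI : HasDerivAt (fun t => ∫ τ in a..t, H τ q) (H t₀ q) t₀ :=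
    intervalIntegral.integral_hasDerivAt_right (hc.intervalIntegrable _ _)
      (hc.stronglyMeasurableAtFilter _ _) hc.continuousAt
  have hphase : HasFDerivAt (fun z : ℝ × E n => phase H a z.1 z.2 q)
      (((innerSL ℝ q).comp (ContinuousLinearMap.snd ℝ ℝ (E n))) -
        (H t₀ q) • ContinuousLinearMap.fst ℝ ℝ (E n)) (t₀, x₀) := by
    have h1 : HasFDerivAt (fun z : ℝ × E n => inner ℝ z.2 q)
        ((innerSL ℝ q).comp (ContinuousLinearMap.snd ℝ ℝ (E n))) (t₀, x₀) := by
      have := ((innerSL ℝ q).comp (ContinuousLinearMap.snd ℝ ℝ (E n))).hasFDerivAt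
        (x := (t₀, x₀))
      refine this.congr_of_eventuallyEq (.of_forall fun z => ?_)
      simp [real_inner_comm]
    have hI' : HasFDerivAt (fun z : ℝ × E n => ∫ τ in a..z.1, H τ q)
        (H t₀ q • ContinuousLinearMap.fst ℝ ℝ (E n)) (t₀, x₀) :=
      HasDerivAt.comp_hasFDerivAt (f := Prod.fst) (t₀, x₀) hI hasFDerivAt_fst
    exact h1.sub hI'
  have hzero := hloc.hasFDerivAt_eq_zero (hphase.sub hv)
  have hv' : ∀ w : ℝ × E n, v' w = inner ℝ q w.2 - H t₀ q * w.1 := fun w => by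
    have := DFunLike.congr_fun hzero w
    simp at this
    linarith
  have hpq : p = q := by
    refine ext_inner_left ℝ fun y => ?_
    rw [← hp, hv']
    simp [real_inner_comm]
  rw [hv', hpq]
  simp

/-! ### From the extended-real formula and (A1) to layers. -/

theorem conjugate_coe_le_iff (ω : E n → ℝ) (q : E n) (m : ℝ) :
    conjugate (fun y => (ω y : EReal)) q ≤ (m : EReal) ↔ ConjLE ω q m := by
  simp only [conjugate, iSup_le_iff, ← EReal.coe_sub, EReal.coe_le_coe_iff, ConjLE]

section Objective

variable (H : ℝ → E n → ℝ) (ω : E n → ℝ) (a t : ℝ)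

theorem coe_le_objective_iff (x q : E n) (m : ℝ) :
    (m : EReal) ≤ objective H (fun y => (ω y : EReal)) a t x q ↔
      ConjLE ω q (phase H a t x q - m) := by
  rw [← conjugate_coe_le_iff, objective, phase]
  induction conjugate (fun y => (ω y : EReal)) q with
  | bot => simp
  | top =>
    simp only [EReal.sub_top, EReal.bot_sub, le_bot_iff, EReal.coe_ne_bot, top_le_iff,
      EReal.coe_ne_top]
  | coe c =>
    rw [← EReal.coe_sub, ← EReal.coe_sub, EReal.coe_le_coe_iff, EReal.coe_le_coe_iff]
    constructor <;> intro h <;> linarith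

theorem objective_ne_top (x q : E n) : objective H (fun y => (ω y : EReal)) a t x q ≠ ⊤ := by
  intro h
  -- This `m` would bound the conjugate by `-ω 0 - 1`, which the point `0` refutes.
  have := (coe_le_objective_iff H ω a t x q (phase H a t x q + ω 0 + 1)).1 (h ▸ le_top) 0
  simp only [inner_zero_left] at this
  linarith

theorem hopf_eq_iSup_objective (x : E n) :
    hopf H (fun y => (ω y : EReal)) a t x = ⨆ q, objective H (fun y => (ω y : EReal)) a t x q := by
  rw [hopf, conjugate]
  refine iSup_congr fun q => ?_
  rw [objective, real_inner_comm]
  induction conjugate (fun y => (ω y : EReal)) q with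
  | bot => simp
  | top => simp
  | coe c =>
    rw [← EReal.coe_add, ← EReal.coe_sub, ← EReal.coe_sub, ← EReal.coe_sub]
    congr 1
    ring

variable {H ω a t}

theorem upperSemicontinuous_objective (hH : Continuous H.uncurry) (x : E n) :
    UpperSemicontinuous (objective H (fun y => (ω y : EReal)) a t x) := by
  rw [upperSemicontinuous_iff_isClosed_preimage]
  intro y
  induction y with
  | bot => simp
  | top =>
    have : objective H (fun y => (ω y : EReal)) a t x ⁻¹' Ici ⊤ = ∅ := by
      ext q
      simpa using objective_ne_top H ω a t x q
    rw [this]; exact isClosed_empty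
  | coe m =>
    have hp : Continuous fun q => phase H a t x q :=
      (continuous_phase hH a).comp (by fun_prop : Continuous fun q : E n => ((t, x), q))
    have : objective H (fun y => (ω y : EReal)) a t x ⁻¹' Ici (m : EReal)
        = ⋂ y : E n, {q | inner ℝ y q - ω y ≤ phase H a t x q - m} := by
      ext q
      simp only [mem_preimage, mem_Ici, coe_le_objective_iff, ConjLE, mem_iInter, mem_ofPred_eq]
    rw [this]
    exact isClosed_iInter fun y => isClosed_le (by fun_prop) (by fun_prop)

/-- If the values outside a ball stay below the supremum over the ball, the objective attains a
finite maximum in that ball. -/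
theorem exists_isMax_objective (hω : ConvexOn ℝ univ ω) (hH : Continuous H.uncurry) {x : E n}
    {N : ℝ} (hN : 0 < N)
    (h : ∀ p : E n, N < ‖p‖ → objective H (fun y => (ω y : EReal)) a t x p <
      ⨆ q ∈ {q : E n | ‖q‖ ≤ N}, objective H (fun y => (ω y : EReal)) a t x q) :
    ∃ (q₀ : E n) (r : ℝ), objective H (fun y => (ω y : EReal)) a t x q₀ = r ∧
      (∀ p, objective H (fun y => (ω y : EReal)) a t x p ≤ r) ∧
      ∀ p, (r : EReal) ≤ objective H (fun y => (ω y : EReal)) a t x p → ‖p‖ ≤ N := by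
  set f := objective H (fun y => (ω y : EReal)) a t x with hf
  obtain ⟨q₀, -, hmax⟩ := ((upperSemicontinuous_objective (ω := ω) (a := a) (t := t) hH
    x).upperSemicontinuousOn (Metric.closedBall 0 N)).exists_isMaxOn
    ⟨0, by simpa using hN.le⟩ (isCompact_closedBall (0 : E n) N)
  have hsup : ⨆ q ∈ {q : E n | ‖q‖ ≤ N}, f q ≤ f q₀ :=
    iSup₂_le fun q hq => hmax (by simpa using hq)
  have hout : ∀ p, N < ‖p‖ → f p < f q₀ := fun p hp => (h p hp).trans_le hsup
  have hall : ∀ p, f p ≤ f q₀ := fun p => by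
    rcases le_or_gt ‖p‖ N with hp | hp
    · exact hmax (by simpa using hp)
    · exact (hout p hp).le
  -- A subgradient of `ω` at `0` has finite conjugate, so the objective is finite there.
  have hbot : f q₀ ≠ ⊥ := by
    obtain ⟨q, hq⟩ := exists_subgradient hω 0
    have : ((phase H a t x q + ω 0 : ℝ) : EReal) ≤ f q :=
      (coe_le_objective_iff H ω a t x q _).2 fun y => by
        have := hq y
        rw [sub_zero] at this
        linarith
    exact ((EReal.bot_lt_coe _).trans_le (this.trans (hall q))).ne'
  have hr : f q₀ = ((f q₀).toReal : EReal) :=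
    (EReal.coe_toReal (objective_ne_top H ω a t x q₀) hbot).symm
  refine ⟨q₀, (f q₀).toReal, hr, fun p => hr ▸ hall p, fun p hp => ?_⟩
  by_contra! hlt
  exact absurd (hout p hlt) (not_lt.2 (hr ▸ hp))

end Objective

variable {H : ℝ → E n → ℝ} {ω : E n → ℝ} {a b : ℝ}

/-- Under (A1) the Hopf-type function is finite and is a layer in the sense of `IsLayer`. -/
theorem CondA1.isLayer (hA1 : CondA1 H (fun y => (ω y : EReal)) a b)
    (hω : ConvexOn ℝ univ ω) (hH : Continuous H.uncurry) :
    ∃ U : ℝ → E n → ℝ, IsLayer H ω a b U ∧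
      ∀ t ∈ Icc a b, ∀ x, hopf H (fun y => (ω y : EReal)) a t x = U t x := by
  have key : ∀ t ∈ Icc a b, ∀ x N, 0 < N →
      (∀ p : E n, N < ‖p‖ → objective H (fun y => (ω y : EReal)) a t x p <
        ⨆ q ∈ {q : E n | ‖q‖ ≤ N}, objective H (fun y => (ω y : EReal)) a t x q) →
      ∃ q₀ : E n, objective H (fun y => (ω y : EReal)) a t x q₀
          = (hopf H (fun y => (ω y : EReal)) a t x).toReal ∧
        hopf H (fun y => (ω y : EReal)) a t x
          = (hopf H (fun y => (ω y : EReal)) a t x).toReal ∧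
        ∀ p, ((hopf H (fun y => (ω y : EReal)) a t x).toReal : EReal) ≤
          objective H (fun y => (ω y : EReal)) a t x p → ‖p‖ ≤ N := by
    intro t _ x N hN h
    obtain ⟨q₀, r, hq₀, hle, hloc⟩ := exists_isMax_objective hω hH hN h
    have hr : hopf H (fun y => (ω y : EReal)) a t x = r := by
      rw [hopf_eq_iSup_objective]
      exact le_antisymm (iSup_le hle) (hq₀ ▸ le_iSup _ q₀)
    rw [hr, EReal.toReal_coe]
    exact ⟨q₀, hq₀, rfl, hloc⟩
  have key' : ∀ t ∈ Icc a b, ∀ x, ∃ q₀ : E n, objective H (fun y => (ω y : EReal)) a t x q₀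
          = (hopf H (fun y => (ω y : EReal)) a t x).toReal ∧
        hopf H (fun y => (ω y : EReal)) a t x
          = (hopf H (fun y => (ω y : EReal)) a t x).toReal := fun t ht x => by
    obtain ⟨r, hr, N, hN, h⟩ := hA1 t ht x
    obtain ⟨q₀, h1, h2, -⟩ := key t ht x N hN (h t ht x (by simpa using hr))
    exact ⟨q₀, h1, h2⟩
  refine ⟨fun t x => (hopf H (fun y => (ω y : EReal)) a t x).toReal, ⟨?_, ?_, ?_⟩, ?_⟩
  · intro t ht x q m hq
    obtain ⟨-, -, h⟩ := key' t ht x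
    have h1 : ((phase H a t x q - m : ℝ) : EReal) ≤ hopf H (fun y => (ω y : EReal)) a t x := by
      rw [hopf_eq_iSup_objective]
      refine le_iSup_of_le q ((coe_le_objective_iff H ω a t x q _).2 ?_)
      simpa using hq
    rwa [h, EReal.coe_le_coe_iff] at h1
  · intro t ht x
    obtain ⟨q₀, h, -⟩ := key' t ht x
    exact ⟨q₀, (coe_le_objective_iff H ω a t x q₀ _).1 h.ge⟩
  · intro t₀ ht₀ x₀
    obtain ⟨r, hr, N, hN, h⟩ := hA1 t₀ ht₀ x₀
    have hc : Continuous fun z : ℝ × E n => |z.1 - t₀| + ‖z.2 - x₀‖ := by fun_prop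
    refine ⟨N, ?_⟩
    filter_upwards [hc.continuousAt.eventually_lt_const (by simpa using hr)] with z hz hz1 q hq
    obtain ⟨-, -, -, hloc⟩ := key z.1 hz1 z.2 N hN (h z.1 hz1 z.2 hz)
    exact hloc q ((coe_le_objective_iff H ω a z.1 z.2 q _).2 hq)
  · intro t ht x
    obtain ⟨-, -, h⟩ := key' t ht x
    exact h

/-! ### Changing the Hamiltonian outside the time interval. -/

theorem integral_hamiltonian_congr {H' : ℝ → E n → ℝ} (h : ∀ t ∈ Icc a b, H t = H' t)
    {t : ℝ} (ht : t ∈ Icc a b) (q : E n) :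
    ∫ τ in a..t, H τ q = ∫ τ in a..t, H' τ q :=
  intervalIntegral.integral_congr fun τ hτ => by
    rw [uIcc_of_le ht.1] at hτ
    simp only [h τ ⟨hτ.1, hτ.2.trans ht.2⟩]

theorem hopf_congr {H' : ℝ → E n → ℝ} (h : ∀ t ∈ Icc a b, H t = H' t)
    (ω : E n → EReal) {t : ℝ} (ht : t ∈ Icc a b) :
    hopf H ω a t = hopf H' ω a t := by
  funext x
  simp only [hopf, integral_hamiltonian_congr h ht]

theorem CondA1.congr {H' : ℝ → E n → ℝ} (h : ∀ t ∈ Icc a b, H t = H' t)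
    {ω : E n → EReal} (hA1 : CondA1 H ω a b) : CondA1 H' ω a b := by
  intro t₀ ht₀ x₀
  obtain ⟨r, hr, N, hN, H1⟩ := hA1 t₀ ht₀ x₀
  refine ⟨r, hr, N, hN, fun t ht x hx p hp => ?_⟩
  simpa only [objective, integral_hamiltonian_congr h ht] using H1 t ht x hx p hp

theorem CondA2.congr {H' : ℝ → E n → ℝ} (h : ∀ t ∈ Icc a b, H t = H' t)
    (hA2 : CondA2 H a b) : CondA2 H' a b := by
  rcases hA2 with (h1 | h1) | ⟨g, f, k, h1, h2⟩
  · exact Or.inl (Or.inl fun t ht => h t ht ▸ h1 t ht)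
  · exact Or.inl (Or.inr fun t ht => h t ht ▸ h1 t ht)
  · exact Or.inr ⟨g, f, k, fun t ht p => h t ht ▸ h1 t ht p, h2⟩

/-! ### Gluing the layers. -/

/-- Two consecutive layers, the second restarted from the function reached by the first, form a
viscosity solution. -/
theorem isViscositySolution_of_layers {T t₁ : ℝ} (ht₁ : t₁ ∈ Ioo 0 T) {σ : E n → ℝ}
    (hσ : ConvexOn ℝ univ σ) (hH : Continuous H.uncurry) {U₁ U₂ u : ℝ → E n → ℝ}
    (hU₁ : IsLayer H σ 0 t₁ U₁) (hU₂ : IsLayer H (U₁ t₁) t₁ T U₂)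
    (hA2 : CondA2 H 0 t₁) (hA2' : CondA2 H t₁ T)
    (hu₁ : ∀ t ∈ Icc 0 t₁, u t = U₁ t) (hu₂ : ∀ t ∈ Icc t₁ T, u t = U₂ t) :
    IsViscositySolution T (fun t _ p => H t p) σ u := by
  refine ⟨?_, fun x => ?_, ?_⟩
  · have hsplit : Icc (0 : ℝ) T ×ˢ (univ : Set (E n)) = Icc 0 t₁ ×ˢ univ ∪ Icc t₁ T ×ˢ univ := by
      rw [← union_prod, Icc_union_Icc_eq_Icc ht₁.1.le ht₁.2.le]
    rw [hsplit]
    refine ContinuousOn.union_of_isClosed ?_ ?_ (isClosed_Icc.prod isClosed_univ)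
      (isClosed_Icc.prod isClosed_univ)
    · exact (hU₁.continuousOn hH).congr fun z hz => by simp only [hu₁ z.1 hz.1]
    · exact (hU₂.continuousOn hH).congr fun z hz => by simp only [hu₂ z.1 hz.1]
  · rw [hu₁ 0 (left_mem_Icc.2 ht₁.1.le), hU₁.initial ht₁.1.le hσ]
  intro v hv t₀ ht₀ x₀
  have hvd : DifferentiableAt ℝ v (t₀, x₀) :=
    (hv.contDiffAt ((isOpen_Ioo.prod isOpen_univ).mem_nhds ⟨ht₀, mem_univ _⟩)).differentiableAt
      one_ne_zero
  set v' := fderiv ℝ v (t₀, x₀) with hv'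
  have hvf : HasFDerivAt v v' (t₀, x₀) := hvd.hasFDerivAt
  have hderiv : deriv (fun t => v (t, x₀)) t₀ = v' (1, 0) :=
    (hvf.comp_hasDerivAt t₀ ((hasDerivAt_id t₀).prodMk (hasDerivAt_const t₀ x₀))).deriv
  have hvx : HasFDerivAt (fun x => v (t₀, x)) (v'.comp (ContinuousLinearMap.inr ℝ ℝ (E n))) x₀ :=
    hvf.comp x₀ (hasFDerivAt_prodMk_right t₀ x₀)
  have hgrad : ∀ y, v' (0, y) = inner ℝ y (gradient (fun x => v (t₀, x)) x₀) := fun y => by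
    rw [gradient, hvx.fderiv, real_inner_comm, InnerProductSpace.toDual_symm_apply]
    simp
  rw [hderiv]
  have hnear : ∀ᶠ z : ℝ × E n in 𝓝 (t₀, x₀), z.1 ∈ Ioo 0 T :=
    (continuous_fst.tendsto (t₀, x₀)).eventually (Ioo_mem_nhds ht₀.1 ht₀.2)
  have hgt : ∀ {s}, s < t₀ → ∀ᶠ z : ℝ × E n in 𝓝 (t₀, x₀), s < z.1 := fun hs =>
    (continuous_fst.tendsto (t₀, x₀)).eventually_const_lt hs
  rcases le_or_gt t₀ t₁ with hle | hgt₁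
  · have ht₀m : t₀ ∈ Icc 0 t₁ := ⟨ht₀.1.le, hle⟩
    constructor
    · intro hmax
      obtain ⟨q, hq⟩ := hU₁.attained t₀ ht₀m x₀
      refine subsolution_of_phase_le (a := 0) (q := q)
        (m := phase H 0 t₀ x₀ q - U₁ t₀ x₀) hH hvf ?_ ?_ hmax hgrad
      · filter_upwards [hnear] with z hz
        rcases le_total z.1 t₁ with hz1 | hz1
        · rw [hu₁ z.1 ⟨hz.1.le, hz1⟩]
          exact hU₁.upper z.1 ⟨hz.1.le, hz1⟩ z.2 q _ hq
        · rw [hu₂ z.1 ⟨hz1, hz.2.le⟩]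
          -- The phase of `q` lies below `U₁ t₁`, which bounds the conjugate of the new datum at
          -- `q`; so the same phase continues below `U₂` past `t₁`.
          have hconj : ConjLE (U₁ t₁) q
              (phase H 0 t₀ x₀ q - U₁ t₀ x₀ + ∫ τ in (0 : ℝ)..t₁, H τ q) := fun y => by
            have := hU₁.upper t₁ (right_mem_Icc.2 ht₁.1.le) y q _ hq
            rw [phase] at this
            linarith
          have := hU₂.upper z.1 ⟨hz1, hz.2.le⟩ z.2 q _ hconj
          have hc : Continuous fun τ => H τ q :=
            hH.comp (by fun_prop : Continuous fun τ : ℝ => (τ, q))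
          have hadd := intervalIntegral.integral_add_adjacent_intervals
            (hc.intervalIntegrable (μ := MeasureTheory.volume) 0 t₁) (hc.intervalIntegrable t₁ z.1)
          simp only [phase] at this ⊢
          linarith
      · simp [hu₁ t₀ ht₀m]
    · intro hmin
      refine hU₁.supersolution hH hA2 ⟨ht₀.1, hle⟩ hvf ?_ hgrad
      filter_upwards [hmin, hnear] with z hz hz1 hz2
      simpa only [hu₁ t₀ ht₀m, hu₁ z.1 ⟨hz1.1.le, hz2.trans hle⟩] using hz
  · have ht₀m : t₀ ∈ Icc t₁ T := ⟨hgt₁.le, ht₀.2.le⟩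
    constructor
    · intro hmax
      obtain ⟨q, hq⟩ := hU₂.attained t₀ ht₀m x₀
      refine subsolution_of_phase_le (a := t₁) (q := q)
        (m := phase H t₁ t₀ x₀ q - U₂ t₀ x₀) hH hvf ?_ ?_ hmax hgrad
      · filter_upwards [hnear, hgt hgt₁] with z hz hz1
        rw [hu₂ z.1 ⟨hz1.le, hz.2.le⟩]
        exact hU₂.upper z.1 ⟨hz1.le, hz.2.le⟩ z.2 q _ hq
      · simp [hu₂ t₀ ht₀m]
    · intro hmin
      refine hU₂.supersolution hH hA2' ⟨hgt₁, ht₀.2.le⟩ hvf ?_ hgrad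
      filter_upwards [hmin, hnear, hgt hgt₁] with z hz hz1 hz2 _
      simpa only [hu₂ t₀ ht₀m, hu₂ z.1 ⟨hz2.le, hz1.2.le⟩] using hz

end LayeredHJ

open LayeredHJ

theorem theorem3p3 (n : ℕ) (T t₁ : ℝ) (ht₁ : t₁ ∈ Set.Ioo 0 T)
    (σ : LayeredHJ.E n → ℝ) (hσ : ConvexOn ℝ Set.univ σ)
    (H : ℝ → LayeredHJ.E n → ℝ)
    (hH : ContDiffOn ℝ 1 (fun z : ℝ × LayeredHJ.E n => H z.1 z.2) (Set.Icc 0 T ×ˢ Set.univ))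
    (hA1 : LayeredHJ.CondA1 H (fun y => (σ y : EReal)) 0 t₁)
    (hA2 : LayeredHJ.CondA2 H 0 t₁)
    (hA1' : LayeredHJ.CondA1 H (LayeredHJ.layered H σ t₁ t₁) t₁ T)
    (hA2' : LayeredHJ.CondA2 H t₁ T) :
    -- the two formulas hold on `[0, t₁]` and on `[t₁, T]`, both endpoints included
    (∀ t ∈ Set.Icc 0 t₁, ∀ x : LayeredHJ.E n,
      LayeredHJ.layered H σ t₁ t x = LayeredHJ.hopf H (fun y => (σ y : EReal)) 0 t x) ∧
    (∀ t ∈ Set.Icc t₁ T, ∀ x : LayeredHJ.E n,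
      LayeredHJ.layered H σ t₁ t x =
        LayeredHJ.hopf H (LayeredHJ.layered H σ t₁ t₁) t₁ t x) ∧
    -- the function is finite, so that passing to real values is harmless
    (∀ t ∈ Set.Icc 0 T, ∀ x : LayeredHJ.E n,
      LayeredHJ.layered H σ t₁ t x ≠ ⊤ ∧ LayeredHJ.layered H σ t₁ t x ≠ ⊥) ∧
    LayeredHJ.IsViscositySolution T (fun t _ p => H t p) σ
      (fun t x => (LayeredHJ.layered H σ t₁ t x).toReal) := by
  obtain ⟨h0, hT⟩ := ht₁
  have hT0 : (0 : ℝ) ≤ T := (h0.trans hT).le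
  -- a globally continuous Hamiltonian that agrees with `H` on `[0, T]`
  set K : ℝ → E n → ℝ := fun t => H (projIcc 0 T hT0 t) with hK
  have hKH : ∀ t ∈ Icc 0 T, H t = K t := fun t ht => by simp only [hK, projIcc_of_mem hT0 ht]
  have hKc : Continuous K.uncurry :=
    hH.continuousOn.comp_continuous
      (f := fun z : ℝ × E n => ((projIcc 0 T hT0 z.1 : ℝ), z.2))
      (by fun_prop) fun z => ⟨(projIcc 0 T hT0 z.1).2, mem_univ _⟩
  have hKH₁ : ∀ t ∈ Icc 0 t₁, H t = K t := fun t ht => hKH t ⟨ht.1, ht.2.trans hT.le⟩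
  have hKH₂ : ∀ t ∈ Icc t₁ T, H t = K t := fun t ht => hKH t ⟨h0.le.trans ht.1, ht.2⟩
  obtain ⟨U₁, hU₁, hopf₁⟩ := (hA1.congr hKH₁).isLayer hσ hKc
  have hlay₁ : ∀ t ∈ Icc 0 t₁, ∀ x, layered H σ t₁ t x = U₁ t x := fun t ht x => by
    rw [layered, if_pos ht.2, hopf_congr hKH₁ _ ht, hopf₁ t ht]
  have hmid : t₁ ∈ Icc 0 t₁ := right_mem_Icc.2 h0.le
  have hmid' : t₁ ∈ Icc t₁ T := left_mem_Icc.2 hT.le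
  have hdatum : layered H σ t₁ t₁ = fun y => (U₁ t₁ y : EReal) := funext fun x => hlay₁ t₁ hmid x
  have hdatum' : hopf H (fun y => (σ y : EReal)) 0 t₁ = fun y => (U₁ t₁ y : EReal) :=
    funext fun x => by rw [hopf_congr hKH₁ _ hmid, hopf₁ t₁ hmid]
  rw [hdatum] at hA1' ⊢
  obtain ⟨U₂, hU₂, hopf₂⟩ := (hA1'.congr hKH₂).isLayer (hU₁.convexOn hmid) hKc
  have hhopf₂ : ∀ t ∈ Icc t₁ T, ∀ x,
      hopf H (fun y => (U₁ t₁ y : EReal)) t₁ t x = U₂ t x := fun t ht x => by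
    rw [hopf_congr hKH₂ _ ht, hopf₂ t ht]
  have hlay₂ : ∀ t ∈ Icc t₁ T, ∀ x, layered H σ t₁ t x = U₂ t x := fun t ht x => by
    rcases ht.1.eq_or_lt with rfl | hlt
    · rw [hlay₁ _ hmid, hU₂.initial hT.le (hU₁.convexOn hmid)]
    · rw [layered, if_neg hlt.not_ge, hdatum', hhopf₂ t ht]
  refine ⟨fun t ht x => by rw [layered, if_pos ht.2], fun t ht x => ?_, fun t ht x => ?_, ?_⟩
  · rw [hlay₂ t ht, hhopf₂ t ht]
  · rcases le_total t t₁ with hle | hle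
    · simp [hlay₁ t ⟨ht.1, hle⟩]
    · simp [hlay₂ t ⟨hle, ht.2⟩]
  · have hsol := isViscositySolution_of_layers (u := fun t x => (layered H σ t₁ t x).toReal)
      ⟨h0, hT⟩ hσ hKc hU₁ hU₂ (hA2.congr hKH₁) (hA2'.congr hKH₂)
      (fun t ht => funext fun x => by rw [hlay₁ t ht, EReal.toReal_coe])
      (fun t ht => funext fun x => by rw [hlay₂ t ht, EReal.toReal_coe])
    refine ⟨hsol.1, hsol.2.1, fun v hv t₀ ht₀ x₀ => ?_⟩
    have := hsol.2.2 v hv t₀ ht₀ x₀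
    simpa only [← hKH t₀ (Ioo_subset_Icc_self ht₀)] using this
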